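/- **Setting.** Let $\mathcal E=(\mathcal E^0,\mathcal E^1,r,s)$ be a directed graph with $\mathcal E^0,\mathcal E^1$ nonempty, let $\mathcal L:\mathcal E^1\to\mathcal A$ be a labelling map into an alphabet $\mathcal A$, and extend $\mathcal L$ to finite paths letter by letter. Let $\mathcal L^*$ be the set of labels of finite paths, including the empty word $\omega$. For $A\subseteq\mathcal E^0$ and $\alpha\in\mathcal L^*$ let $r(A,\alpha)$ be the set of ranges of paths with label $\alpha$ and source in $A$, with $r(A,\omega)=A$; put $r(\alpha)=r(\mathcal E^0,\alpha)$, $\mathcal L(A\mathcal E^1)=\{\mathcal L(e): e\in\mathcal E^1,\ s(e)\in A\}$, and $\mathcal E^0_{sink}=\{v: s^{-1}(v)=\emptyset\}$. Let $\mathcal B\subseteq\mathcal P(\mathcal E^0)$ be closed under binary intersections and unions, under relative ranges ($r(A,\alpha)\in\mathcal B$ for $A\in\mathcal B$, $\alpha\in\mathcal L^*$) and under relative complements, with $r(\alpha)\in\mathcal B$ for all $\alpha\in\mathcal L^*\setminus\{\omega\}$. Assume that the labelled space $(\mathcal E,\mathcal L,\mathcal B)$ is weakly left resolving: $r(A\cap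 B,\alpha)=r(A,\alpha)\cap r(B,\alpha)$ for $A,B\in\mathcal B$, $\alpha\in\mathcal L^*\setminus\{\omega\}$. Put $\mathcal B_\alpha=\{A\in\mathcal B: A\subseteq r(\alpha)\}$, ordered by inclusion. Let $S$ be the inverse semigroup consisting of a zero $0$ and the triples $(\alpha,A,\beta)$ with $\alpha,\beta\in\mathcal L^*$ and $\emptyset\ne A\in\mathcal B_\alpha\cap\mathcal B_\beta$, with product $$(\alpha,A,\beta)(\gamma,B,\delta)=\begin{cases}(\alpha\gamma',\,r(A,\gamma')\cap B,\,\delta)&\text{if }\gamma=\beta\gamma',\\(\alpha,\,A\cap r(B,\beta'),\,\delta\beta')&\text{if }\beta=\gamma\beta',\\0&\text{otherwise,}\end{cases}$$ where a triple with empty middle set is read as $0$. Its idempotents $E(S)=\{(\alpha,A,\alpha)\}\cup\{0\}$ form a semilattice with $p\wedge q=pq$ and least element $0$. A *filter* in a partially ordered set with least element $0$ is a nonempty, upward closed, downward directed subset not containing $0$; an *ultrafilter* is a filter not properly contained in another filter. A set $Z\subseteq\{z: z\le x\}$ is a *cover* for $x$ if for each nonzero $y\le x$ there is $z\in Z$ with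 $z\wedge y\ne0$. A filter $\xi$ in a semilattice with $0$ is *tight* if its characteristic function $\phi_\xi$ satisfies $\bigvee_{z\in Z}\phi_\xi(z)=\phi_\xi(x)$ for every $x$ and every finite cover $Z$ for $x$. A filter $\xi$ in $E(S)$ is of *finite type* with word $\alpha$, written $\xi=\xi^\alpha$, if $\alpha$ has the largest length among all words $\beta$ with $(\beta,B,\beta)\in\xi$ for some $B$; then $\xi_{|\alpha|}=\{A\in\mathcal B_\alpha:(\alpha,A,\alpha)\in\xi\}$. If there is no such longest word, $\xi$ is of *infinite type*. **Theorem.** The tight filters in $E(S)$ are exactly: (i) the ultrafilters of infinite type; (ii) the filters of finite type $\xi^\alpha$ such that $\xi_{|\alpha|}$ is an ultrafilter in $\mathcal B_\alpha$ and for each $A\in\xi_{|\alpha|}$ at least one of the following conditions holds: (a) $\mathcal L(A\mathcal E^1)$ is infinite; (b) there exists $B\in\mathcal B_\alpha$ such that $\emptyset\ne B\subseteq A\cap\mathcal E^0_{sink}$. -/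

import Mathlib

/-! ### Filters, ultrafilters and tight filters in ordered sets -/

/-- A filter in a partially ordered set with least element. -/
structure IsOrderFilter {P : Type*} [PartialOrder P] [OrderBot P] (ξ : Set P) : Prop where
  nonempty : ξ.Nonempty
  bot_notMem : (⊥ : P) ∉ ξ
  mem_of_le : ∀ x ∈ ξ, ∀ y, x ≤ y → y ∈ ξ
  directed : ∀ x ∈ ξ, ∀ y ∈ ξ, ∃ z ∈ ξ, z ≤ x ∧ z ≤ y

/-- An ultrafilter: a filter which is not properly contained in any filter. -/
def IsOrderUltrafilter {P : Type*} [PartialOrder P] [OrderBot P] (ξ : Set P) : Prop :=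
  IsOrderFilter ξ ∧ ∀ η : Set P, IsOrderFilter η → ξ ⊆ η → ξ = η

/-- A character of a semilattice with zero; the values are taken in `Prop`, which serves as the
two-element Boolean algebra `{0, 1}`. -/
structure IsCharacter {E : Type*} [SemilatticeInf E] [OrderBot E] (φ : E → Prop) : Prop where
  ne_zero : φ ≠ fun _ => ⊥
  map_bot : φ ⊥ = ⊥
  map_inf : ∀ x y, φ (x ⊓ y) = (φ x ⊓ φ y)

/-- `Z` is a cover for `x`: `Z` lies below `x`, and every nonzero `y ≤ x` meets some element
of `Z`. -/
def IsCover {E : Type*} [SemilatticeInf E] [OrderBot E] (Z : Set E) (x : E) : Prop :=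
  (∀ z ∈ Z, z ≤ x) ∧ ∀ y ≤ x, y ≠ ⊥ → ∃ z ∈ Z, z ⊓ y ≠ ⊥

/-- A tight character: the join of its values over any finite cover of `x` is its value
at `x`. -/
def IsTightCharacter {E : Type*} [SemilatticeInf E] [OrderBot E] (φ : E → Prop) : Prop :=
  IsCharacter φ ∧ ∀ (x : E) (Z : Finset E), IsCover (Z : Set E) x → Z.sup φ = φ x

/-- A tight filter: a filter whose characteristic function is a tight character. -/
def IsTightFilter {E : Type*} [SemilatticeInf E] [OrderBot E] (ξ : Set E) : Prop :=
  IsOrderFilter ξ ∧ IsTightCharacter (fun x => x ∈ ξ)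

/-! ### Labelled graphs -/

/-- A directed graph with vertex set `V` and edge set `E`, whose edges are labelled by the
alphabet `𝓐`. -/
structure LabelledGraph (V E 𝓐 : Type*) where
  /-- source of an edge -/
  s : E → V
  /-- range of an edge -/
  r : E → V
  /-- label of an edge -/
  lab : E → 𝓐

namespace LabelledGraph

variable {V E 𝓐 : Type*} (G : LabelledGraph V E 𝓐)

/-- `G.HasPath u α v`: there is a finite path with source `u`, range `v` and label `α`
(vertices are the paths of length zero). -/
inductive HasPath : V → List 𝓐 → V → Prop
  | nil (v : V) : HasPath v [] v
  | cons (e : E) {α : List 𝓐} {v : V} : HasPath (G.r e) α v → HasPath (G.s e) (G.lab e :: α) v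

/-- The set of finite labelled paths, including the empty word. -/
def labelledPaths : Set (List 𝓐) :=
  {α | α = [] ∨ ∃ u v, G.HasPath u α v}

/-- The relative range `r(A, α)`. -/
def relRange (A : Set V) (α : List 𝓐) : Set V :=
  {v | ∃ u ∈ A, G.HasPath u α v}

/-- The range `r(α)`. -/
def range (α : List 𝓐) : Set V :=
  G.relRange Set.univ α

/-- The set `L(A E¹)` of labels of the edges whose source is in `A`. -/
def labelsFrom (A : Set V) : Set 𝓐 :=
  {a | ∃ e, G.s e ∈ A ∧ G.lab e = a}

/-- The set of sinks. -/
def sinks : Set V :=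
  {v | ∀ e, G.s e ≠ v}

theorem hasPath_nil {u v : V} : G.HasPath u [] v ↔ u = v := by
  constructor
  · intro h
    cases h
    rfl
  · rintro rfl
    exact .nil _

theorem hasPath_append {u v : V} {α β : List 𝓐} :
    G.HasPath u (α ++ β) v ↔ ∃ w, G.HasPath u α w ∧ G.HasPath w β v := by
  induction α generalizing u with
  | nil => simp [hasPath_nil]
  | cons a α ih =>
    constructor
    · intro h
      cases h with
      | cons e h =>
        obtain ⟨w, h1, h2⟩ := ih.1 h
        exact ⟨w, .cons e h1, h2⟩
    · rintro ⟨w, h1, h2⟩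
      cases h1 with
      | cons e h => exact .cons e (ih.2 ⟨w, h, h2⟩)

@[simp] theorem relRange_nil (A : Set V) : G.relRange A [] = A := by
  ext v
  simp [relRange, hasPath_nil]

theorem relRange_append (A : Set V) (α β : List 𝓐) :
    G.relRange A (α ++ β) = G.relRange (G.relRange A α) β := by
  ext v
  simp only [relRange, hasPath_append, Set.mem_ofPred_eq]
  constructor
  · rintro ⟨u, hu, w, h1, h2⟩
    exact ⟨w, ⟨u, hu, h1⟩, h2⟩
  · rintro ⟨w, ⟨u, hu, h1⟩, h2⟩
    exact ⟨u, hu, w, h1, h2⟩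

theorem relRange_mono {A B : Set V} (h : A ⊆ B) (α : List 𝓐) :
    G.relRange A α ⊆ G.relRange B α :=
  fun _ ⟨u, hu, p⟩ => ⟨u, h hu, p⟩

theorem mem_labelledPaths_of_mem {A : Set V} {α : List 𝓐} {v : V} (h : v ∈ G.relRange A α) :
    α ∈ G.labelledPaths := by
  obtain ⟨u, -, p⟩ := h
  exact Or.inr ⟨u, v, p⟩

theorem drop_mem_labelledPaths {α : List 𝓐} (h : α ∈ G.labelledPaths) (n : ℕ) :
    α.drop n ∈ G.labelledPaths := by
  rcases h with rfl | ⟨u, v, p⟩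
  · exact Or.inl (by simp)
  · rw [← List.take_append_drop n α, hasPath_append] at p
    obtain ⟨w, -, p⟩ := p
    exact Or.inr ⟨w, v, p⟩

end LabelledGraph

/-! ### Labelled spaces -/

/-- A labelled space: a labelled graph with an accommodating family of sets of vertices. -/
structure LabelledSpace (V E 𝓐 : Type*) extends LabelledGraph V E 𝓐 where
  /-- the accommodating family -/
  fam : Set (Set V)
  relRange_mem : ∀ A ∈ fam, ∀ α ∈ toLabelledGraph.labelledPaths, toLabelledGraph.relRange A α ∈ fam
  inter_mem : ∀ A ∈ fam, ∀ B ∈ fam, A ∩ B ∈ fam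
  union_mem : ∀ A ∈ fam, ∀ B ∈ fam, A ∪ B ∈ fam
  range_mem : ∀ α ∈ toLabelledGraph.labelledPaths, α ≠ [] → toLabelledGraph.range α ∈ fam

namespace LabelledSpace

variable {V E 𝓐 : Type*}

/-- Weakly left resolving labelled spaces. -/
class WeaklyLeftResolving (L : LabelledSpace V E 𝓐) : Prop where
  relRange_inter : ∀ A ∈ L.fam, ∀ B ∈ L.fam, ∀ α ∈ L.labelledPaths, α ≠ [] →
    L.relRange (A ∩ B) α = L.relRange A α ∩ L.relRange B α

/-- The accommodating family is closed under relative complements. -/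
class ClosedUnderRelCompl (L : LabelledSpace V E 𝓐) : Prop where
  diff_mem : ∀ A ∈ L.fam, ∀ B ∈ L.fam, A \ B ∈ L.fam

/-- The members of the accommodating family contained in `r(α)`, ordered by inclusion. -/
abbrev FamAt (L : LabelledSpace V E 𝓐) (α : List 𝓐) : Type _ :=
  {A : Set V // A ∈ L.fam ∧ A ⊆ L.range α}

theorem empty_mem (L : LabelledSpace V E 𝓐) [Nonempty E] [L.ClosedUnderRelCompl] :
    ∅ ∈ L.fam := by
  obtain ⟨e⟩ := ‹Nonempty E›
  have h : L.range [L.lab e] ∈ L.fam :=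
    L.range_mem _ (Or.inr ⟨L.s e, L.r e, .cons e (.nil _)⟩) (by simp)
  simpa using ClosedUnderRelCompl.diff_mem _ h _ h

/-- The least element is the empty set. -/
instance (L : LabelledSpace V E 𝓐) [Nonempty E] [L.ClosedUnderRelCompl] (α : List 𝓐) :
    OrderBot (L.FamAt α) where
  bot := ⟨∅, L.empty_mem, Set.empty_subset _⟩
  bot_le A := Set.empty_subset A.1

/-! ### The inverse semigroup of a labelled space -/

/-- Triples `(α, A, β)` of labelled paths `α`, `β` and a nonempty `A` in the accommodating family
contained in `r(α)` and in `r(β)`. -/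
@[ext]
structure Triple (L : LabelledSpace V E 𝓐) where
  /-- first word -/
  fst : List 𝓐
  /-- middle set -/
  mid : Set V
  /-- last word -/
  lst : List 𝓐
  fst_mem : fst ∈ L.labelledPaths
  lst_mem : lst ∈ L.labelledPaths
  mid_mem : mid ∈ L.fam
  mid_subset_fst : mid ⊆ L.range fst
  mid_subset_lst : mid ⊆ L.range lst
  mid_nonempty : mid.Nonempty

/-- The inverse semigroup `S`: the triples with nonempty middle set, and a zero element
to which all the triples with empty middle set are collapsed. -/
inductive S (L : LabelledSpace V E 𝓐)
  | zero : S L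
  | of (t : L.Triple) : S L

instance (L : LabelledSpace V E 𝓐) : Zero L.S := ⟨S.zero⟩

/-- The class in `S` of the triple `(α, A, β)`, which is zero if `A` is empty. -/
noncomputable def S.mk (L : LabelledSpace V E 𝓐) (α : List 𝓐) (A : Set V) (β : List 𝓐)
    (hA : A ∈ L.fam) (hα : A ⊆ L.range α) (hβ : A ⊆ L.range β) : L.S :=
  open Classical in
  if h : A.Nonempty then
    S.of ⟨α, A, β, L.mem_labelledPaths_of_mem (hα h.some_mem),
      L.mem_labelledPaths_of_mem (hβ h.some_mem), hA, hα, hβ, h⟩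
  else 0

theorem relRange_subset_range (L : LabelledSpace V E 𝓐) {A : Set V} {α : List 𝓐}
    (h : A ⊆ L.range α) (β : List 𝓐) : L.relRange A β ⊆ L.range (α ++ β) := by
  rw [LabelledGraph.range, LabelledGraph.relRange_append]
  exact L.relRange_mono h β

/-- The product `(α, A, β) (γ, B, δ)`: it is `(α γ', r(A, γ') ∩ B, δ)` if `γ = β γ'`, it is
`(α, A ∩ r(B, β'), δ β')` if `β = γ β'`, and it is zero otherwise. -/
noncomputable def Triple.mul {L : LabelledSpace V E 𝓐} (s t : L.Triple) : L.S :=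
  open Classical in
  if s.lst <+: t.fst then
    S.mk L (s.fst ++ t.fst.drop s.lst.length)
      (L.relRange s.mid (t.fst.drop s.lst.length) ∩ t.mid) t.lst
      (L.inter_mem _ (L.relRange_mem _ s.mid_mem _ (L.drop_mem_labelledPaths t.fst_mem _)) _
        t.mid_mem)
      (Set.inter_subset_left.trans (L.relRange_subset_range s.mid_subset_fst _))
      (Set.inter_subset_right.trans t.mid_subset_lst)
  else if t.fst <+: s.lst then
    S.mk L s.fst (s.mid ∩ L.relRange t.mid (s.lst.drop t.fst.length))
      (t.lst ++ s.lst.drop t.fst.length)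
      (L.inter_mem _ s.mid_mem _
        (L.relRange_mem _ t.mid_mem _ (L.drop_mem_labelledPaths s.lst_mem _)))
      (Set.inter_subset_left.trans s.mid_subset_fst)
      (Set.inter_subset_right.trans (L.relRange_subset_range t.mid_subset_lst _))
  else 0

noncomputable instance (L : LabelledSpace V E 𝓐) : Mul L.S :=
  ⟨fun p q => match p, q with
    | S.of s, S.of t => s.mul t
    | _, _ => 0⟩

/-- An auxiliary faithful description of the elements of `S` by ternary relations, used to prove
the semigroup laws. -/
def S.Rel {L : LabelledSpace V E 𝓐} (p : L.S) (μ : List 𝓐) (v : V) (ν : List 𝓐) : Prop :=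
  ∃ t : L.Triple, p = S.of t ∧ ∃ ε, μ = t.fst ++ ε ∧ ν = t.lst ++ ε ∧ v ∈ L.relRange t.mid ε

theorem S.rel_some {L : LabelledSpace V E 𝓐} {t : L.Triple} {μ ν : List 𝓐} {v : V} :
    S.Rel (S.of t) μ v ν ↔
      ∃ ε, μ = t.fst ++ ε ∧ ν = t.lst ++ ε ∧ v ∈ L.relRange t.mid ε := by
  constructor
  · rintro ⟨t', h, h'⟩
    cases h
    exact h'
  · intro h
    exact ⟨t, rfl, h⟩

theorem S.rel_zero {L : LabelledSpace V E 𝓐} {μ ν : List 𝓐} {v : V} :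
    ¬ S.Rel (0 : L.S) μ v ν := by
  rintro ⟨t, h, -⟩
  cases h

theorem S.rel_mk {L : LabelledSpace V E 𝓐} {α β : List 𝓐} {A : Set V} {hA : A ∈ L.fam}
    {hα : A ⊆ L.range α} {hβ : A ⊆ L.range β} {μ ν : List 𝓐} {v : V} :
    S.Rel (S.mk L α A β hA hα hβ) μ v ν ↔
      ∃ ε, μ = α ++ ε ∧ ν = β ++ ε ∧ v ∈ L.relRange A ε := by
  by_cases h : A.Nonempty
  · rw [S.mk, dif_pos h, S.rel_some]
  · rw [S.mk, dif_neg h]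
    refine ⟨fun h' => (S.rel_zero h').elim, ?_⟩
    rintro ⟨ε, -, -, u, hu, -⟩
    exact (h ⟨u, hu⟩).elim

theorem S.rel_ext {L : LabelledSpace V E 𝓐} {p q : L.S}
    (h : ∀ μ v ν, S.Rel p μ v ν ↔ S.Rel q μ v ν) : p = q := by
  have key : ∀ t : L.Triple, ∀ v ∈ t.mid, S.Rel (S.of t) t.fst v t.lst := fun t v hv =>
    S.rel_some.2 ⟨[], by simp, by simp, by simpa using hv⟩
  match p, q, h with
  | S.zero, S.zero, _ => rfl
  | S.zero, S.of t, h =>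
    obtain ⟨v, hv⟩ := t.mid_nonempty
    exact (S.rel_zero ((h _ _ _).2 (key t v hv))).elim
  | S.of t, S.zero, h =>
    obtain ⟨v, hv⟩ := t.mid_nonempty
    exact (S.rel_zero ((h _ _ _).1 (key t v hv))).elim
  | S.of s, S.of t, h =>
    obtain ⟨v, hv⟩ := s.mid_nonempty
    obtain ⟨w, hw⟩ := t.mid_nonempty
    obtain ⟨ε, h1, h2, -⟩ := S.rel_some.1 ((h _ _ _).1 (key s v hv))
    obtain ⟨δ, h3, h4, -⟩ := S.rel_some.1 ((h _ _ _).2 (key t w hw))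
    have hε : ε = [] := by
      have := congrArg List.length h1
      have h5 := congrArg List.length h3
      simp only [List.length_append] at this h5
      exact List.eq_nil_of_length_eq_zero (by omega)
    subst hε
    simp only [List.append_nil] at h1 h2
    have hst : ∀ u, u ∈ s.mid ↔ u ∈ t.mid := by
      intro u
      constructor
      · intro hu
        obtain ⟨ε, h5, -, h6⟩ := S.rel_some.1 ((h _ _ _).1 (key s u hu))
        rw [h1] at h5
        have : ε = [] := by simpa using h5
        simpa [this] using h6
      · intro hu
        obtain ⟨ε, h5, -, h6⟩ := S.rel_some.1 ((h _ _ _).2 (key t u hu))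
        rw [h1] at h5
        have : ε = [] := by simpa using h5
        simpa [this] using h6
    exact congrArg S.of (Triple.ext h1 (Set.ext hst) h2)

theorem relRange_inter (L : LabelledSpace V E 𝓐) [L.WeaklyLeftResolving] {A B : Set V}
    (hA : A ∈ L.fam) (hB : B ∈ L.fam) (α : List 𝓐) :
    L.relRange (A ∩ B) α = L.relRange A α ∩ L.relRange B α := by
  by_cases h0 : α = []
  · simp [h0]
  by_cases h : α ∈ L.labelledPaths
  · exact WeaklyLeftResolving.relRange_inter A hA B hB α h h0
  · have (C : Set V) : L.relRange C α = ∅ :=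
      Set.eq_empty_of_forall_notMem fun v hv => h (L.mem_labelledPaths_of_mem hv)
    simp [this]

theorem S.rel_mul {L : LabelledSpace V E 𝓐} [L.WeaklyLeftResolving] {p q : L.S}
    {μ ν : List 𝓐} {v : V} :
    S.Rel (p * q) μ v ν ↔ ∃ κ, S.Rel p μ v κ ∧ S.Rel q κ v ν := by
  match p, q with
  | S.zero, q =>
    exact ⟨fun h => (S.rel_zero h).elim, fun ⟨_, h, _⟩ => (S.rel_zero h).elim⟩
  | S.of s, S.zero =>
    exact ⟨fun h => (S.rel_zero h).elim, fun ⟨_, _, h⟩ => (S.rel_zero h).elim⟩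
  | S.of s, S.of t =>
    change S.Rel (s.mul t) μ v ν ↔ _
    simp only [S.rel_some]
    unfold Triple.mul
    split_ifs with h1 h2
    · obtain ⟨γ, hγ⟩ := h1
      have hd : t.fst.drop s.lst.length = γ := by rw [← hγ]; simp
      have hm : L.relRange s.mid γ ∈ L.fam :=
        L.relRange_mem _ s.mid_mem _ (hd ▸ L.drop_mem_labelledPaths t.fst_mem _)
      simp only [S.rel_mk, hd, L.relRange_inter hm t.mid_mem]
      constructor
      · rintro ⟨ε, e1, e2, h3, h4⟩
        refine ⟨t.fst ++ ε, ⟨γ ++ ε, by simp [e1], by simp [← hγ], ?_⟩, ε, rfl, e2, h4⟩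
        rwa [LabelledGraph.relRange_append]
      · rintro ⟨κ, ⟨ε, e1, e2, h3⟩, ε', e3, e4, h4⟩
        have : ε = γ ++ ε' := by
          rw [e2, ← hγ, List.append_assoc] at e3
          exact List.append_cancel_left e3
        subst this
        rw [LabelledGraph.relRange_append] at h3
        exact ⟨ε', by simp [e1], e4, h3, h4⟩
    · obtain ⟨γ, hγ⟩ := h2
      have hd : s.lst.drop t.fst.length = γ := by rw [← hγ]; simp
      have hm : L.relRange t.mid γ ∈ L.fam :=
        L.relRange_mem _ t.mid_mem _ (hd ▸ L.drop_mem_labelledPaths s.lst_mem _)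
      simp only [S.rel_mk, hd, L.relRange_inter s.mid_mem hm]
      constructor
      · rintro ⟨ε, e1, e2, h3, h4⟩
        refine ⟨s.lst ++ ε, ⟨ε, e1, rfl, h3⟩, γ ++ ε, by simp [← hγ], by simp [e2], ?_⟩
        rwa [LabelledGraph.relRange_append]
      · rintro ⟨κ, ⟨ε, e1, e2, h3⟩, ε', e3, e4, h4⟩
        have : ε' = γ ++ ε := by
          rw [e2, ← hγ, List.append_assoc] at e3
          exact (List.append_cancel_left e3).symm
        subst this
        rw [LabelledGraph.relRange_append] at h4
        exact ⟨ε, e1, by simp [e4], h3, h4⟩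
    · refine ⟨fun h => (S.rel_zero h).elim, ?_⟩
      rintro ⟨κ, ⟨ε, e1, e2, h3⟩, ε', e3, e4, h4⟩
      rcases List.prefix_or_prefix_of_prefix (⟨ε, e2.symm⟩ : s.lst <+: κ)
        (⟨ε', e3.symm⟩ : t.fst <+: κ) with h | h
      · exact (h1 h).elim
      · exact (h2 h).elim

noncomputable instance (L : LabelledSpace V E 𝓐) [L.WeaklyLeftResolving] :
    SemigroupWithZero L.S where
  mul_assoc p q t := S.rel_ext fun μ v ν => by
    simp only [S.rel_mul]
    constructor
    · rintro ⟨κ, ⟨κ', h1, h2⟩, h3⟩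
      exact ⟨κ', h1, κ, h2, h3⟩
    · rintro ⟨κ', h1, κ, h2, h3⟩
      exact ⟨κ, ⟨κ', h1, h2⟩, h3⟩
  zero_mul _ := rfl
  mul_zero p := by cases p <;> rfl

theorem S.mk_mul_self {L : LabelledSpace V E 𝓐} [L.WeaklyLeftResolving] {α : List 𝓐} {A : Set V}
    {hA : A ∈ L.fam} {hα : A ⊆ L.range α} :
    S.mk L α A α hA hα hα * S.mk L α A α hA hα hα = S.mk L α A α hA hα hα :=
  S.rel_ext fun μ v ν => by
    simp only [S.rel_mul, S.rel_mk]
    constructor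
    · rintro ⟨κ, ⟨ε, rfl, rfl, h⟩, ε', e1, rfl, h'⟩
      exact ⟨ε', e1, rfl, h'⟩
    · rintro ⟨ε, rfl, rfl, h⟩
      exact ⟨_, ⟨ε, rfl, rfl, h⟩, ε, rfl, rfl, h⟩

theorem S.rel_eq_of_idem {L : LabelledSpace V E 𝓐} [L.WeaklyLeftResolving] {p : L.S}
    (hp : p * p = p) {μ ν : List 𝓐} {v : V} (h : S.Rel p μ v ν) : μ = ν := by
  match p, hp, h with
  | S.zero, _, h => exact (S.rel_zero h).elim
  | S.of t, hp, h =>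
    obtain ⟨w, hw⟩ := t.mid_nonempty
    have h1 : S.Rel (S.of t) t.fst w t.lst :=
      S.rel_some.2 ⟨[], by simp, by simp, by simpa using hw⟩
    rw [← hp, S.rel_mul] at h1
    obtain ⟨κ, h2, h3⟩ := h1
    obtain ⟨ε, e1, e2, -⟩ := S.rel_some.1 h2
    obtain ⟨ε', e3, e4, -⟩ := S.rel_some.1 h3
    have hε : ε = [] := by simpa using e1
    have hε' : ε' = [] := by simpa using e4
    subst hε hε'
    have hf : t.fst = t.lst := by simpa using e3.symm.trans e2
    obtain ⟨δ, d1, d2, -⟩ := S.rel_some.1 h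
    rw [d1, d2, hf]

theorem S.rel_mul_idem {L : LabelledSpace V E 𝓐} [L.WeaklyLeftResolving] {p q : L.S}
    (hp : p * p = p) (hq : q * q = q) {μ ν : List 𝓐} {v : V} :
    S.Rel (p * q) μ v ν ↔ S.Rel p μ v ν ∧ S.Rel q μ v ν := by
  rw [S.rel_mul]
  constructor
  · rintro ⟨κ, h1, h2⟩
    obtain rfl := S.rel_eq_of_idem hp h1
    obtain rfl := S.rel_eq_of_idem hq h2
    exact ⟨h1, h2⟩
  · rintro ⟨h1, h2⟩
    obtain rfl := S.rel_eq_of_idem hp h1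
    exact ⟨_, h1, h2⟩

theorem S.idem_comm {L : LabelledSpace V E 𝓐} [L.WeaklyLeftResolving] {p q : L.S}
    (hp : p * p = p) (hq : q * q = q) : p * q = q * p :=
  S.rel_ext fun μ v ν => by rw [S.rel_mul_idem hp hq, S.rel_mul_idem hq hp, and_comm]

/-- The set `E(S)` of idempotents of `S`. -/
@[ext]
structure ES (L : LabelledSpace V E 𝓐) where
  /-- the underlying element of `S` -/
  val : L.S
  mul_self : val * val = val

/-- `E(S)` is a semilattice: the meet of `p` and `q` is `p q`, and `p ≤ q` means `p q = p`. -/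
noncomputable instance (L : LabelledSpace V E 𝓐) [L.WeaklyLeftResolving] :
    SemilatticeInf L.ES where
  le p q := p.val * q.val = p.val
  inf p q := ⟨p.val * q.val, by
    rw [mul_assoc, ← mul_assoc q.val, S.idem_comm q.mul_self p.mul_self, mul_assoc p.val q.val q.val, q.mul_self,
      ← mul_assoc, p.mul_self]⟩
  le_refl p := p.mul_self
  le_trans p q t (h : p.val * q.val = p.val) (h' : q.val * t.val = q.val) := by
    rw [← h, mul_assoc, h']
  le_antisymm p q (h : p.val * q.val = p.val) (h' : q.val * p.val = q.val) := by
    apply ES.ext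
    rw [← h, S.idem_comm p.mul_self q.mul_self, h']
  inf_le_left p q := by
    change p.val * q.val * p.val = p.val * q.val
    rw [mul_assoc, S.idem_comm q.mul_self p.mul_self, ← mul_assoc, p.mul_self]
  inf_le_right p q := by
    change p.val * q.val * q.val = p.val * q.val
    rw [mul_assoc, q.mul_self]
  le_inf p q t (h : p.val * q.val = p.val) (h' : p.val * t.val = p.val) := by
    change p.val * (q.val * t.val) = p.val
    rw [← mul_assoc, h, h']

/-- The least element of `E(S)` is the zero of `S`. -/
noncomputable instance (L : LabelledSpace V E 𝓐) [L.WeaklyLeftResolving] : OrderBot L.ES where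
  bot := ⟨0, zero_mul 0⟩
  bot_le p := zero_mul p.val

/-- The idempotent `(α, A, α)`. -/
noncomputable def ES.ofSet {L : LabelledSpace V E 𝓐} [L.WeaklyLeftResolving] (α : List 𝓐)
    (A : L.FamAt α) : L.ES :=
  ⟨S.mk L α A.1 α A.2.1 A.2.2 A.2.2, S.mk_mul_self⟩

/-! ### Words of filters in `E(S)` -/

/-- The family of all `A` contained in `r(α)` with `(α, A, α) ∈ ξ`; for a filter `ξ` with
associated word `α` this is the family denoted `ξ_n` for `n = |α|`. -/
def levelSet {L : LabelledSpace V E 𝓐} [L.WeaklyLeftResolving] (ξ : Set L.ES) (α : List 𝓐) :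
    Set (L.FamAt α) :=
  {A | ES.ofSet α A ∈ ξ}

/-- `α` occurs in `ξ` and has the largest length among all words occurring in `ξ`: the filter `ξ`
is of finite type with associated word `α`. -/
def IsLargestWord {L : LabelledSpace V E 𝓐} [L.WeaklyLeftResolving] (ξ : Set L.ES)
    (α : List 𝓐) : Prop :=
  (levelSet ξ α).Nonempty ∧ ∀ β : List 𝓐, (levelSet ξ β).Nonempty → β.length ≤ α.length

/-- A filter of infinite type: a filter without a largest word. -/
def IsInfiniteType {L : LabelledSpace V E 𝓐} [L.WeaklyLeftResolving] (ξ : Set L.ES) : Prop :=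
  IsOrderFilter ξ ∧ ¬ ∃ α : List 𝓐, IsLargestWord ξ α

end LabelledSpace

/-! ### Filters in semilattices -/

/-! An idempotent (α, A, α) is treated as the set of pairs (αε, v) with v ∈ r(A, ε). By weak left
resolution meets become intersections, and the order is inclusion. A filter is tight iff it meets
every finite cover of each of its members, so every ultrafilter is tight.

Let ξ be tight. The cover {A ∩ B, A \ B} of A makes each nonempty level of ξ an ultrafilter
(`levelSet_isOrderUltrafilter`). If ξ has arbitrarily long words, any member of a larger filter can
be pushed to a level of ξ at a longer word, so maximality of the levels gives maximality of ξ. If α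
is the largest word and some A at level α violates both (a) and (b), the finitely many (αa, r(A, a),
αa) cover (α, A, α), and ξ would contain a longer word (`isCover_extensions`).

Conversely, let ξ be as in (ii) and let Z be a finite cover of x ∈ ξ that misses ξ. Some (α, A, α) ∈
ξ below x is disjoint from every z ∈ Z whose word does not properly extend α. A letter emitted by A
and unused in Z, or a nonempty set of sinks in A, then yields a nonzero element below x that avoids
all of Z (`IsLargestWord.isTightFilter`). -/

theorem IsOrderFilter.inf_mem {P : Type*} [SemilatticeInf P] [OrderBot P] {ξ : Set P}
    (h : IsOrderFilter ξ) {x y : P} (hx : x ∈ ξ) (hy : y ∈ ξ) : x ⊓ y ∈ ξ := by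
  obtain ⟨z, hz, hzx, hzy⟩ := h.directed x hx y hy
  exact h.mem_of_le z hz _ (le_inf hzx hzy)

theorem IsOrderFilter.ne_bot {P : Type*} [PartialOrder P] [OrderBot P] {ξ : Set P}
    (h : IsOrderFilter ξ) {x : P} (hx : x ∈ ξ) : x ≠ ⊥ :=
  fun h0 => h.bot_notMem (h0 ▸ hx)

/-- An element outside an ultrafilter is disjoint from some member of it. -/
theorem IsOrderUltrafilter.exists_inf_eq_bot {P : Type*} [SemilatticeInf P] [OrderBot P]
    {ξ : Set P} (h : IsOrderUltrafilter ξ) {z : P} (hz : z ∉ ξ) : ∃ y ∈ ξ, y ⊓ z = ⊥ := by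
  by_contra! hne
  -- The filter generated by `ξ` and `z` omits ⊥ exactly because no `y ⊓ z` vanishes; maximality
  -- then puts `z` in `ξ`.
  have hη : IsOrderFilter {x : P | ∃ y ∈ ξ, y ⊓ z ≤ x} :=
    { nonempty := let ⟨y, hy⟩ := h.1.nonempty; ⟨y, y, hy, inf_le_left⟩
      bot_notMem := fun ⟨y, hy, hle⟩ => hne y hy (le_bot_iff.1 hle)
      mem_of_le := fun x ⟨y, hy, hle⟩ w hw => ⟨y, hy, hle.trans hw⟩
      directed := fun x ⟨y, hy, hle⟩ x' ⟨y', hy', hle'⟩ =>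
        ⟨y ⊓ y' ⊓ z, ⟨y ⊓ y', h.1.inf_mem hy hy', le_rfl⟩,
          (inf_le_inf_right z inf_le_left).trans hle,
          (inf_le_inf_right z inf_le_right).trans hle'⟩ }
  have heq := h.2 _ hη fun y hy => ⟨y, hy, inf_le_left⟩
  obtain ⟨y, hy⟩ := h.1.nonempty
  exact hz (heq ▸ ⟨y, hy, inf_le_right⟩)

/-- Given a member of a filter for each element of a finite set, the filter has a member below
all of them. -/
theorem IsOrderFilter.exists_le_forall {P ι : Type*} [PartialOrder P] [OrderBot P] {ξ : Set P}
    (h : IsOrderFilter ξ) {x : P} (hx : x ∈ ξ) (Z : Finset ι) (Q : ι → P → Prop)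
    (hQ : ∀ z ∈ Z, ∃ y ∈ ξ, Q z y) (hmono : ∀ z y y', y' ≤ y → Q z y → Q z y') :
    ∃ y ∈ ξ, y ≤ x ∧ ∀ z ∈ Z, Q z y := by
  classical
  induction Z using Finset.induction_on with
  | empty => exact ⟨x, hx, le_rfl, by simp⟩
  | insert a Z _ ih =>
    obtain ⟨y, hy, hyx, hall⟩ := ih fun z hz => hQ z (Finset.mem_insert_of_mem hz)
    obtain ⟨w, hw, hwQ⟩ := hQ a (Finset.mem_insert_self a Z)
    obtain ⟨u, hu, huy, huw⟩ := h.directed y hy w hw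
    refine ⟨u, hu, huy.trans hyx, fun z hz => ?_⟩
    rcases Finset.mem_insert.1 hz with rfl | hz
    · exact hmono _ w u huw hwQ
    · exact hmono z y u huy (hall z hz)

theorem Finset.sup_prop_iff {ι : Type*} (Z : Finset ι) (φ : ι → Prop) :
    Z.sup φ ↔ ∃ z ∈ Z, φ z := by
  classical
  induction Z using Finset.induction_on with
  | empty => simp
  | insert a Z _ ih => simp [Finset.sup_insert, ih]

theorem IsOrderFilter.isCharacter {P : Type*} [SemilatticeInf P] [OrderBot P] {ξ : Set P}
    (h : IsOrderFilter ξ) : IsCharacter (fun x => x ∈ ξ) where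
  ne_zero h0 := let ⟨x, hx⟩ := h.nonempty; by
    have : (x ∈ ξ) = False := congrFun h0 x
    rwa [this] at hx
  map_bot := eq_false h.bot_notMem
  map_inf x y := propext
    ⟨fun hxy => ⟨h.mem_of_le _ hxy _ inf_le_left, h.mem_of_le _ hxy _ inf_le_right⟩,
      fun ⟨hx, hy⟩ => h.inf_mem hx hy⟩

/-- A filter is tight if and only if it meets every finite cover of each of its members. -/
theorem isTightFilter_iff {P : Type*} [SemilatticeInf P] [OrderBot P] {ξ : Set P} :
    IsTightFilter ξ ↔ IsOrderFilter ξ ∧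
      ∀ x ∈ ξ, ∀ Z : Finset P, IsCover (Z : Set P) x → ∃ z ∈ Z, z ∈ ξ := by
  constructor
  · rintro ⟨h, -, ht⟩
    refine ⟨h, fun x hx Z hZ => ?_⟩
    rw [← Finset.sup_prop_iff Z (fun z => z ∈ ξ), ht x Z hZ]
    exact hx
  · rintro ⟨h, ht⟩
    refine ⟨h, h.isCharacter, fun x Z hZ => propext ?_⟩
    rw [Finset.sup_prop_iff]
    -- A cover lies below `x`, so its join never exceeds the value at `x`; only `x ∈ ξ` carries
    -- content.
    exact ⟨fun ⟨z, hz, hzξ⟩ => h.mem_of_le z hzξ x (hZ.1 z hz), fun hx => ht x hx Z hZ⟩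

theorem IsOrderUltrafilter.isTightFilter {P : Type*} [SemilatticeInf P] [OrderBot P] {ξ : Set P}
    (h : IsOrderUltrafilter ξ) : IsTightFilter ξ := by
  refine isTightFilter_iff.2 ⟨h.1, fun x hx Z hZ => ?_⟩
  by_contra! hne
  -- Finiteness of `Z` gives one member of `ξ` below `x` that is disjoint from all of `Z`.
  obtain ⟨y, hy, hyx, hall⟩ := h.1.exists_le_forall hx Z (fun z y => y ⊓ z = ⊥)
    (fun z hz => h.exists_inf_eq_bot (hne z hz))
    (fun z y y' hle h0 => le_bot_iff.1 (h0 ▸ inf_le_inf_right z hle))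
  obtain ⟨z, hz, hzy⟩ := hZ.2 y hyx (h.1.ne_bot hy)
  exact hzy (by rw [inf_comm, hall z hz])

namespace LabelledSpace

variable {V E 𝓐 : Type*} {L : LabelledSpace V E 𝓐}

/-! ### Relative ranges -/

theorem relRange_union (A B : Set V) (α : List 𝓐) :
    L.relRange (A ∪ B) α = L.relRange A α ∪ L.relRange B α := by
  ext v
  constructor
  · rintro ⟨u, hu | hu, p⟩
    exacts [Or.inl ⟨u, hu, p⟩, Or.inr ⟨u, hu, p⟩]
  · rintro (⟨u, hu, p⟩ | ⟨u, hu, p⟩)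
    exacts [⟨u, Or.inl hu, p⟩, ⟨u, Or.inr hu, p⟩]

/-- For a word that labels no path the relative range is empty, so closure holds for all words and
`FamAt.relRange` needs no side condition. -/
theorem relRange_mem_fam [Nonempty E] [L.ClosedUnderRelCompl] {A : Set V} (hA : A ∈ L.fam)
    (α : List 𝓐) : L.relRange A α ∈ L.fam := by
  by_cases h : α ∈ L.labelledPaths
  · exact L.relRange_mem A hA α h
  · rw [Set.eq_empty_of_forall_notMem fun v hv => h (L.mem_labelledPaths_of_mem hv)]
    exact L.empty_mem

theorem exists_edge_of_mem_relRange_cons {A : Set V} {a : 𝓐} {γ : List 𝓐} {v : V}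
    (h : v ∈ L.relRange A (a :: γ)) : ∃ e, L.s e ∈ A ∧ L.lab e = a := by
  obtain ⟨u, hu, p⟩ := h
  cases p with
  | cons e p => exact ⟨e, hu, rfl⟩

/-! ### The families of sets contained in a range -/

instance (α : List 𝓐) : SemilatticeInf (L.FamAt α) where
  inf A B := ⟨A.1 ∩ B.1, L.inter_mem _ A.2.1 _ B.2.1, Set.inter_subset_left.trans A.2.2⟩
  inf_le_left A B := (Set.inter_subset_left : A.1 ∩ B.1 ⊆ A.1)
  inf_le_right A B := (Set.inter_subset_right : A.1 ∩ B.1 ⊆ B.1)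
  le_inf A B C h h' := (Set.subset_inter h h' : A.1 ⊆ B.1 ∩ C.1)

/-- The relative complement in `FamAt`. -/
def FamAt.diff [L.ClosedUnderRelCompl] {α : List 𝓐} (A B : L.FamAt α) : L.FamAt α :=
  ⟨A.1 \ B.1, ClosedUnderRelCompl.diff_mem _ A.2.1 _ B.2.1, Set.sdiff_subset.trans A.2.2⟩

/-- The relative range of a member of `FamAt`. -/
def FamAt.relRange [Nonempty E] [L.ClosedUnderRelCompl] {α : List 𝓐} (A : L.FamAt α)
    (γ : List 𝓐) : L.FamAt (α ++ γ) :=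
  ⟨L.relRange A.1 γ, relRange_mem_fam A.2.1 γ, L.relRange_subset_range A.2.2 γ⟩

theorem FamAt.coe_inf {α : List 𝓐} (A B : L.FamAt α) : (A ⊓ B).1 = A.1 ∩ B.1 := rfl

theorem FamAt.nonempty_of_ne_bot [Nonempty E] [L.ClosedUnderRelCompl] {α : List 𝓐}
    {A : L.FamAt α} (h : A ≠ ⊥) : A.1.Nonempty := by
  by_contra h0
  exact h (Subtype.ext (Set.not_nonempty_iff_eq_empty.1 h0))

/-! ### Idempotents as sets of pairs -/

variable [L.WeaklyLeftResolving]

/-- The set of pairs of a word and a vertex represented by an idempotent: `(α, A, α)` represents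
the pairs `(α ε, v)` with `v ∈ r(A, ε)`. -/
def ES.points (p : L.ES) : Set (List 𝓐 × V) :=
  {x | S.Rel p.val x.1 x.2 x.1}

/-- The ternary relation of an idempotent lives on the diagonal μ = ν, so restricting to pairs loses
nothing. -/
theorem ES.points_injective : Function.Injective (ES.points : L.ES → Set (List 𝓐 × V)) := by
  intro p q h
  refine ES.ext (S.rel_ext fun μ v ν => ?_)
  have key : S.Rel p.val μ v μ ↔ S.Rel q.val μ v μ := Set.ext_iff.1 h (μ, v)
  constructor
  · intro hp
    obtain rfl := S.rel_eq_of_idem p.mul_self hp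
    exact key.1 hp
  · intro hq
    obtain rfl := S.rel_eq_of_idem q.mul_self hq
    exact key.2 hq

theorem ES.points_inf (p q : L.ES) : (p ⊓ q).points = p.points ∩ q.points :=
  Set.ext fun _ => S.rel_mul_idem p.mul_self q.mul_self

theorem ES.points_bot : (⊥ : L.ES).points = ∅ :=
  Set.eq_empty_of_forall_notMem fun _ => S.rel_zero (L := L)

theorem ES.le_iff {p q : L.ES} : p ≤ q ↔ p.points ⊆ q.points := by
  rw [← inf_eq_left, ← ES.points_injective.eq_iff, ES.points_inf, Set.inter_eq_left]

theorem ES.ne_bot_iff {p : L.ES} : p ≠ ⊥ ↔ p.points.Nonempty := by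
  rw [Set.nonempty_iff_ne_empty, ← ES.points_bot (L := L), ES.points_injective.ne_iff]

theorem ES.mem_points_ofSet {α : List 𝓐} {A : L.FamAt α} {x : List 𝓐 × V} :
    x ∈ (ES.ofSet α A).points ↔ ∃ ε, x.1 = α ++ ε ∧ x.2 ∈ L.relRange A.1 ε := by
  refine S.rel_mk.trans ?_
  constructor
  · rintro ⟨ε, h, -, h'⟩
    exact ⟨ε, h, h'⟩
  · rintro ⟨ε, h, h'⟩
    exact ⟨ε, h, h, h'⟩

theorem ES.append_mem_points_ofSet {α γ : List 𝓐} {A : L.FamAt α} {v : V} :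
    (α ++ γ, v) ∈ (ES.ofSet α A).points ↔ v ∈ L.relRange A.1 γ := by
  rw [ES.mem_points_ofSet]
  constructor
  · rintro ⟨ε, h, h'⟩
    rwa [List.append_cancel_left h]
  · intro h
    exact ⟨γ, rfl, h⟩

theorem ES.self_mem_points_ofSet {α : List 𝓐} {A : L.FamAt α} {v : V} :
    (α, v) ∈ (ES.ofSet α A).points ↔ v ∈ A.1 := by
  simpa using ES.append_mem_points_ofSet (γ := []) (A := A) (v := v)

theorem ES.ofSet_ne_bot_iff {α : List 𝓐} {A : L.FamAt α} :
    ES.ofSet α A ≠ ⊥ ↔ A.1.Nonempty := by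
  rw [ES.ne_bot_iff]
  constructor
  · rintro ⟨x, hx⟩
    obtain ⟨ε, -, u, hu, -⟩ := ES.mem_points_ofSet.1 hx
    exact ⟨u, hu⟩
  · rintro ⟨v, hv⟩
    exact ⟨(α, v), ES.self_mem_points_ofSet.2 hv⟩

theorem ES.ofSet_mono {α : List 𝓐} {A B : L.FamAt α} (h : A ≤ B) :
    ES.ofSet α A ≤ ES.ofSet α B := by
  refine ES.le_iff.2 fun x hx => ?_
  obtain ⟨ε, h1, h2⟩ := ES.mem_points_ofSet.1 hx
  exact ES.mem_points_ofSet.2 ⟨ε, h1, L.relRange_mono h ε h2⟩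

theorem ES.exists_eq_ofSet {p : L.ES} (hp : p ≠ ⊥) :
    ∃ (α : List 𝓐) (A : L.FamAt α), A.1.Nonempty ∧ p = ES.ofSet α A := by
  obtain ⟨x, t, ht, -⟩ := ES.ne_bot_iff.1 hp
  have hfl : t.fst = t.lst := by
    obtain ⟨v, hv⟩ := t.mid_nonempty
    refine S.rel_eq_of_idem p.mul_self (v := v) ?_
    rw [ht]
    exact S.rel_some.2 ⟨[], by simp, by simp, by simpa using hv⟩
  refine ⟨t.fst, ⟨t.mid, t.mid_mem, t.mid_subset_fst⟩, t.mid_nonempty, ES.ext ?_⟩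
  rw [ht]
  refine Eq.trans ?_ (dif_pos t.mid_nonempty).symm
  exact congrArg S.of (Triple.ext rfl rfl hfl.symm)

/-- Idempotents with nonzero meet have comparable words. -/
theorem ES.prefix_or_prefix {α β : List 𝓐} {A : L.FamAt α} {B : L.FamAt β}
    (h : ES.ofSet α A ⊓ ES.ofSet β B ≠ ⊥) : α <+: β ∨ β <+: α := by
  obtain ⟨x, hx⟩ := ES.ne_bot_iff.1 h
  rw [ES.points_inf] at hx
  obtain ⟨ε, h1, -⟩ := ES.mem_points_ofSet.1 hx.1
  obtain ⟨δ, h2, -⟩ := ES.mem_points_ofSet.1 hx.2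
  exact List.prefix_or_prefix_of_prefix ⟨ε, h1.symm⟩ ⟨δ, h2.symm⟩

/-- Words that branch after α are incomparable. Hence a nonzero idempotent properly extending α
rules out only one next letter. -/
theorem ES.letter_eq {α δ δ' : List 𝓐} {a b : 𝓐} {A : L.FamAt (α ++ a :: δ)}
    {B : L.FamAt (α ++ b :: δ')}
    (h : ES.ofSet (α ++ a :: δ) A ⊓ ES.ofSet (α ++ b :: δ') B ≠ ⊥) : a = b := by
  rcases ES.prefix_or_prefix h with h' | h'
  · exact (List.cons_prefix_cons.1 ((List.prefix_append_right_inj α).1 h')).1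
  · exact (List.cons_prefix_cons.1 ((List.prefix_append_right_inj α).1 h')).1.symm

theorem ES.ofSet_inf {α : List 𝓐} (A B : L.FamAt α) :
    ES.ofSet α A ⊓ ES.ofSet α B = ES.ofSet α (A ⊓ B) := by
  apply ES.points_injective
  ext ⟨μ, v⟩
  rw [ES.points_inf]
  have hinf (ε : List 𝓐) := L.relRange_inter A.2.1 B.2.1 ε
  constructor
  · rintro ⟨h, h'⟩
    obtain ⟨ε, rfl, h1⟩ := ES.mem_points_ofSet.1 h
    rw [ES.append_mem_points_ofSet] at h' ⊢
    rw [FamAt.coe_inf, hinf]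
    exact ⟨h1, h'⟩
  · intro h
    exact ⟨ES.le_iff.1 (ES.ofSet_mono inf_le_left) h, ES.le_iff.1 (ES.ofSet_mono inf_le_right) h⟩

/-- Relative ranges preserve unions, so every point over A comes from A ∩ B or from A \ B. This
cover forces a tight filter to decide between B and its complement. -/
theorem isCover_inf_diff [L.ClosedUnderRelCompl] {α : List 𝓐} (A B : L.FamAt α) :
    IsCover {ES.ofSet α (A ⊓ B), ES.ofSet α (A.diff B)} (ES.ofSet α A) := by
  have hdiff : A.diff B ≤ A := (Set.sdiff_subset : A.1 \ B.1 ⊆ A.1)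
  constructor
  · rintro z (rfl | rfl)
    exacts [ES.ofSet_mono inf_le_left, ES.ofSet_mono hdiff]
  · intro y hy hy0
    obtain ⟨⟨μ, v⟩, hx⟩ := ES.ne_bot_iff.1 hy0
    obtain ⟨ε, rfl, h⟩ := ES.mem_points_ofSet.1 (ES.le_iff.1 hy hx)
    have hv : v ∈ L.relRange A.1 ε := h
    rw [← Set.inter_union_sdiff A.1 B.1, relRange_union] at hv
    rcases hv with hv | hv
    · refine ⟨_, Or.inl rfl, ES.ne_bot_iff.2 ⟨(α ++ ε, v), ?_⟩⟩
      rw [ES.points_inf]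
      exact ⟨ES.append_mem_points_ofSet.2 hv, hx⟩
    · refine ⟨_, Or.inr rfl, ES.ne_bot_iff.2 ⟨(α ++ ε, v), ?_⟩⟩
      rw [ES.points_inf]
      exact ⟨ES.append_mem_points_ofSet.2 hv, hx⟩

/-! ### Words of a filter -/

theorem exists_levelSet_nonempty {ξ : Set L.ES} (h : IsOrderFilter ξ) :
    ∃ α, (levelSet ξ α).Nonempty := by
  obtain ⟨x, hx⟩ := h.nonempty
  obtain ⟨α, A, -, rfl⟩ := ES.exists_eq_ofSet (h.ne_bot hx)
  exact ⟨α, A, hx⟩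

/-- A filter of infinite type has arbitrarily long words. -/
theorem IsInfiniteType.exists_length_ge {ξ : Set L.ES} (h : IsInfiniteType ξ) (n : ℕ) :
    ∃ α, (levelSet ξ α).Nonempty ∧ n ≤ α.length := by
  induction n with
  | zero =>
    obtain ⟨α, hα⟩ := exists_levelSet_nonempty h.1
    exact ⟨α, hα, Nat.zero_le _⟩
  | succ n ih =>
    obtain ⟨α, hα, hn⟩ := ih
    -- If no word were longer than `n`, then `α` would be a largest word.
    by_contra! hlt
    refine h.2 ⟨α, hα, fun β hβ => ?_⟩
    have := hlt β hβ
    omega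

/-- If `α` is the word of a member of a filter, then any other member whose word is not longer
than `α` has a prefix of `α` as its word. -/
theorem exists_append_eq {ξ : Set L.ES} (h : IsOrderFilter ξ) {α β : List 𝓐} {A : L.FamAt α}
    {B : L.FamAt β} (hA : ES.ofSet α A ∈ ξ) (hB : ES.ofSet β B ∈ ξ)
    (hle : β.length ≤ α.length) : ∃ γ, β ++ γ = α := by
  rcases ES.prefix_or_prefix (h.ne_bot (h.inf_mem hA hB)) with h' | h'
  · exact ⟨[], by rw [List.append_nil, h'.eq_of_length_le hle]⟩
  · exact h'

section ClosedUnderRelCompl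

variable [Nonempty E] [L.ClosedUnderRelCompl]

/-- Points over αγε lie in (α, B, α) iff their vertex lies in r(r(B, γ), ε); weak left resolution
then merges the two ranges into one. -/
theorem ES.ofSet_inf_ofSet {α γ : List 𝓐} (A : L.FamAt (α ++ γ)) (B : L.FamAt α) :
    ES.ofSet (α ++ γ) A ⊓ ES.ofSet α B = ES.ofSet (α ++ γ) (A ⊓ B.relRange γ) := by
  apply ES.points_injective
  ext ⟨μ, v⟩
  rw [ES.points_inf]
  have hinf (ε : List 𝓐) : L.relRange (A ⊓ B.relRange γ).1 ε =
      L.relRange A.1 ε ∩ L.relRange B.1 (γ ++ ε) := by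
    rw [LabelledGraph.relRange_append]
    exact L.relRange_inter A.2.1 (B.relRange γ).2.1 ε
  constructor
  · rintro ⟨h, h'⟩
    obtain ⟨ε, rfl, h1⟩ := ES.mem_points_ofSet.1 h
    rw [List.append_assoc, ES.append_mem_points_ofSet] at h'
    rw [ES.append_mem_points_ofSet, hinf]
    exact ⟨h1, h'⟩
  · intro h
    obtain ⟨ε, rfl, h1⟩ := ES.mem_points_ofSet.1 h
    rw [hinf] at h1
    refine ⟨ES.append_mem_points_ofSet.2 h1.1, ?_⟩
    rw [List.append_assoc, ES.append_mem_points_ofSet]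
    exact h1.2

theorem ES.ofSet_relRange_le {α : List 𝓐} (A : L.FamAt α) (γ : List 𝓐) :
    ES.ofSet (α ++ γ) (A.relRange γ) ≤ ES.ofSet α A := by
  rw [← inf_eq_left, ES.ofSet_inf_ofSet, inf_idem]

/-! ### Levels of a filter -/

theorem levelSet_isOrderFilter {ξ : Set L.ES} (h : IsOrderFilter ξ) {α : List 𝓐}
    (hα : (levelSet ξ α).Nonempty) : IsOrderFilter (levelSet ξ α) where
  nonempty := hα
  bot_notMem h0 := by
    have := ES.ofSet_ne_bot_iff.1 (h.ne_bot h0)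
    exact Set.not_nonempty_empty this
  mem_of_le A hA B hAB := h.mem_of_le _ hA _ (ES.ofSet_mono hAB)
  directed A hA B hB := ⟨A ⊓ B, by
    change ES.ofSet α (A ⊓ B) ∈ ξ
    rw [← ES.ofSet_inf]
    exact h.inf_mem hA hB, inf_le_left, inf_le_right⟩

/-- The nonempty levels of a tight filter are ultrafilters. -/
theorem levelSet_isOrderUltrafilter {ξ : Set L.ES} (h : IsTightFilter ξ) {α : List 𝓐}
    (hα : (levelSet ξ α).Nonempty) : IsOrderUltrafilter (levelSet ξ α) := by
  classical
  obtain ⟨hf, ht⟩ := isTightFilter_iff.1 h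
  refine ⟨levelSet_isOrderFilter hf hα, fun η hη hle => hle.antisymm fun B hB => ?_⟩
  obtain ⟨A, hA⟩ := hα
  obtain ⟨z, hz, hzξ⟩ := ht _ hA {ES.ofSet α (A ⊓ B), ES.ofSet α (A.diff B)}
    (by simpa using isCover_inf_diff A B)
  rcases Finset.mem_insert.1 hz with rfl | hz
  · exact hf.mem_of_le _ hzξ _ (ES.ofSet_mono inf_le_right)
  · rw [Finset.mem_singleton] at hz
    subst hz
    -- If tightness selects A \ B, then `η` contains both it and `B`, whose intersection is empty.
    have hm := FamAt.nonempty_of_ne_bot (hη.ne_bot (hη.inf_mem (hle hzξ) hB))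
    obtain ⟨v, hv, hvB⟩ := hm
    exact (hv.2 hvB).elim

/-- A tight filter of infinite type is an ultrafilter. -/
theorem IsInfiniteType.isOrderUltrafilter {ξ : Set L.ES} (h : IsInfiniteType ξ)
    (ht : IsTightFilter ξ) : IsOrderUltrafilter ξ := by
  refine ⟨h.1, fun η hη hle => hle.antisymm fun y hy => ?_⟩
  obtain ⟨β, B, -, rfl⟩ := ES.exists_eq_ofSet (hη.ne_bot hy)
  -- `B` is compared with `ξ` at a level where `ξ` is nonempty, after being pushed forward along
  -- `γ`.
  obtain ⟨α, ⟨A, hA⟩, hlen⟩ := h.exists_length_ge β.length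
  obtain ⟨γ, rfl⟩ := exists_append_eq hη (hle hA) hy hlen
  have hu := levelSet_isOrderUltrafilter ht ⟨A, hA⟩
  have hsub : levelSet ξ (β ++ γ) ⊆ levelSet η (β ++ γ) := fun C hC => hle hC
  have heq := hu.2 _ (levelSet_isOrderFilter hη ⟨A, hle hA⟩) hsub
  have hm : A ⊓ B.relRange γ ∈ levelSet η (β ++ γ) := by
    change ES.ofSet _ _ ∈ η
    rw [← ES.ofSet_inf_ofSet]
    exact hη.inf_mem (hle hA) hy
  rw [← heq] at hm
  exact ht.1.mem_of_le _ hm _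
    ((ES.ofSet_mono inf_le_right).trans (ES.ofSet_relRange_le B γ))

/-! ### Necessity of the condition on the top level -/

/-- If every nonempty subset of `A` in the family emits an edge, then `(α, A, α)` is covered by
its extensions by the letters emitted by `A`. -/
theorem isCover_extensions {α : List 𝓐} (A : L.FamAt α)
    (hA : ∀ B : L.FamAt α, B.1.Nonempty → ¬ B.1 ⊆ A.1 ∩ L.sinks) :
    IsCover ((fun a => ES.ofSet (α ++ [a]) (A.relRange [a])) '' L.labelsFrom A.1)
      (ES.ofSet α A) := by
  constructor
  · rintro _ ⟨a, -, rfl⟩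
    exact ES.ofSet_relRange_le A [a]
  · intro y hy hy0
    -- The first letter after `α` in such a point names a member of the cover that meets `y`.
    suffices ∃ a γ v, (α ++ a :: γ, v) ∈ y.points by
      obtain ⟨a, γ, v, hx⟩ := this
      have hv := ES.append_mem_points_ofSet.1 (ES.le_iff.1 hy hx)
      refine ⟨_, ⟨a, exists_edge_of_mem_relRange_cons hv, rfl⟩,
        ES.ne_bot_iff.2 ⟨(α ++ a :: γ, v), ?_⟩⟩
      rw [ES.points_inf]
      refine ⟨?_, hx⟩
      rw [show α ++ a :: γ = (α ++ [a]) ++ γ by simp]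
      refine ES.append_mem_points_ofSet.2 ?_
      change v ∈ L.relRange (L.relRange A.1 [a]) γ
      rw [← LabelledGraph.relRange_append]
      exact hv
    obtain ⟨β, B, ⟨w, hw⟩, rfl⟩ := ES.exists_eq_ofSet hy0
    obtain ⟨ε, h1, -⟩ :=
      ES.mem_points_ofSet.1 (ES.le_iff.1 hy (ES.self_mem_points_ofSet.2 hw))
    replace h1 : β = α ++ ε := h1
    cases ε with
    | cons a γ => exact ⟨a, γ, w, h1 ▸ ES.self_mem_points_ofSet.2 hw⟩
    | nil =>
      rw [List.append_nil] at h1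
      subst h1
      have hBA : B.1 ⊆ A.1 := fun u hu =>
        ES.self_mem_points_ofSet.1 (ES.le_iff.1 hy (ES.self_mem_points_ofSet.2 hu))
      -- Here `y` has word `α` itself; since `B` is not made of sinks, an edge leaving it lengthens
      -- the word.
      obtain ⟨u, hu, hus⟩ := Set.not_subset.1 (hA B ⟨w, hw⟩)
      have : ∃ e, L.s e = u := by
        by_contra! hne
        exact hus ⟨hBA hu, hne⟩
      obtain ⟨e, rfl⟩ := this
      exact ⟨L.lab e, [], L.r e,
        ES.append_mem_points_ofSet.2 ⟨L.s e, hu, .cons e (.nil _)⟩⟩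

/-- The condition on the top level of a tight filter of finite type. -/
theorem infinite_labelsFrom_or_exists_sinks {ξ : Set L.ES} (h : IsTightFilter ξ) {α : List 𝓐}
    (hα : IsLargestWord ξ α) {A : L.FamAt α} (hA : A ∈ levelSet ξ α) :
    (L.labelsFrom A.1).Infinite ∨ ∃ B : L.FamAt α, B.1.Nonempty ∧ B.1 ⊆ A.1 ∩ L.sinks := by
  by_contra! hc
  obtain ⟨hfin, hsink⟩ := hc
  have hcov := isCover_extensions A hsink
  rw [← (hfin.image _).coe_toFinset] at hcov
  obtain ⟨z, hz, hzξ⟩ := (isTightFilter_iff.1 h).2 _ hA _ hcov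
  obtain ⟨a, -, rfl⟩ := (hfin.image _).mem_toFinset.1 hz
  have := hα.2 (α ++ [a]) ⟨_, hzξ⟩
  simp at this

/-! ### Sufficiency of the condition on the top level -/

/-- An idempotent outside a filter of finite type whose top level is an ultrafilter either is
disjoint from some member of that level, or properly extends the word of the filter. -/
theorem exists_inf_eq_bot_or_extends {ξ : Set L.ES} (h : IsOrderFilter ξ) {α : List 𝓐}
    (hu : IsOrderUltrafilter (levelSet ξ α)) {z : L.ES} (hz : z ∉ ξ) :
    ∃ A ∈ levelSet ξ α, z ⊓ ES.ofSet α A = ⊥ ∨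
      ∃ (a : 𝓐) (δ : List 𝓐) (D : L.FamAt (α ++ a :: δ)), z = ES.ofSet (α ++ a :: δ) D := by
  obtain ⟨A₀, hA₀⟩ := hu.1.nonempty
  by_cases h0 : z ⊓ ES.ofSet α A₀ = ⊥
  · exact ⟨A₀, hA₀, Or.inl h0⟩
  have hz0 : z ≠ ⊥ := by
    rintro rfl
    exact h0 (bot_inf_eq _)
  obtain ⟨δ, D, -, rfl⟩ := ES.exists_eq_ofSet hz0
  -- If the word of `z` is a prefix of `α`, its push-forward to level `α` is not in the level, as
  -- `ξ` is upward closed; the ultrafilter then has a member disjoint from it.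
  have key (γ : List 𝓐) (hγ : δ ++ γ = α) : ∃ A ∈ levelSet ξ α,
      ES.ofSet δ D ⊓ ES.ofSet α A = ⊥ := by
    subst hγ
    have hD : D.relRange γ ∉ levelSet ξ (δ ++ γ) := fun hm =>
      hz (h.mem_of_le _ hm _ (ES.ofSet_relRange_le D γ))
    obtain ⟨A, hA, hAD⟩ := hu.exists_inf_eq_bot hD
    refine ⟨A, hA, ?_⟩
    rw [inf_comm, ES.ofSet_inf_ofSet, hAD]
    by_contra hne
    exact Set.not_nonempty_empty (ES.ofSet_ne_bot_iff.1 hne)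
  rcases ES.prefix_or_prefix h0 with ⟨γ, hγ⟩ | ⟨γ, hγ⟩
  · obtain ⟨A, hA, hAD⟩ := key γ hγ
    exact ⟨A, hA, Or.inl hAD⟩
  · cases γ with
    | nil =>
      obtain ⟨A, hA, hAD⟩ := key [] (by simpa using hγ.symm)
      exact ⟨A, hA, Or.inl hAD⟩
    | cons a γ =>
      subst hγ
      exact ⟨A₀, hA₀, Or.inr ⟨a, γ, D, rfl⟩⟩

/-- A filter of finite type whose top level is an ultrafilter, each of whose members emits
infinitely many labels or contains a nonempty set of sinks, is tight. -/
theorem IsLargestWord.isTightFilter {ξ : Set L.ES} (h : IsOrderFilter ξ) {α : List 𝓐}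
    (hα : IsLargestWord ξ α) (hu : IsOrderUltrafilter (levelSet ξ α))
    (hc : ∀ A ∈ levelSet ξ α, (L.labelsFrom A.1).Infinite ∨
      ∃ B : L.FamAt α, B.1.Nonempty ∧ B.1 ⊆ A.1 ∩ L.sinks) : IsTightFilter ξ := by
  refine isTightFilter_iff.2 ⟨h, fun x hx Z hZ => ?_⟩
  by_contra! hne
  -- Since `α` is largest, the word of `x` is a prefix of it, and `x` can be pushed to level `α`.
  obtain ⟨A₁, hA₁, hA₁x⟩ : ∃ A ∈ levelSet ξ α, ES.ofSet α A ≤ x := by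
    obtain ⟨β, B, -, rfl⟩ := ES.exists_eq_ofSet (h.ne_bot hx)
    obtain ⟨A, hA⟩ := hα.1
    obtain ⟨γ, rfl⟩ := exists_append_eq h hA hx (hα.2 β ⟨B, hx⟩)
    refine ⟨A ⊓ B.relRange γ, ?_, ?_⟩
    · change ES.ofSet _ _ ∈ ξ
      rw [← ES.ofSet_inf_ofSet]
      exact h.inf_mem hA hx
    · rw [← ES.ofSet_inf_ofSet]
      exact inf_le_right
  -- Both alternatives survive shrinking `A`, so one `A` serves all of `Z`.
  obtain ⟨A, hA, hAA₁, hall⟩ := hu.1.exists_le_forall hA₁ Z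
    (fun z A => z ⊓ ES.ofSet α A = ⊥ ∨
      ∃ (a : 𝓐) (δ : List 𝓐) (D : L.FamAt (α ++ a :: δ)), z = ES.ofSet (α ++ a :: δ) D)
    (fun z hz => exists_inf_eq_bot_or_extends h hu (hne z hz))
    (fun z A A' hle => Or.imp_left fun h0 =>
      le_bot_iff.1 (h0 ▸ inf_le_inf_left z (ES.ofSet_mono hle)))
  have hAx : ES.ofSet α A ≤ x := (ES.ofSet_mono hAA₁).trans hA₁x
  -- It suffices to find a nonzero element below `(α, A, α)` disjoint from all proper extensions
  -- of `α` in `Z`.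
  suffices ∃ y, y ≤ ES.ofSet α A ∧ y ≠ ⊥ ∧ ∀ (a : 𝓐) (δ : List 𝓐) (D : L.FamAt (α ++ a :: δ)),
      ES.ofSet (α ++ a :: δ) D ∈ Z → ES.ofSet (α ++ a :: δ) D ⊓ y = ⊥ by
    obtain ⟨y, hyA, hy0, hy⟩ := this
    obtain ⟨z, hz, hzy⟩ := hZ.2 y (hyA.trans hAx) hy0
    rcases hall z hz with h0 | ⟨a, δ, D, rfl⟩
    · exact hzy (le_bot_iff.1 (h0 ▸ inf_le_inf_left z hyA))
    · exact hzy (hy a δ D hz)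
  rcases hc A hA with hinf | ⟨B, hB, hBs⟩
  -- `F` collects the letters following `α` in `Z`. Nonemptiness of `D` is essential: with `D` empty
  -- the idempotent is ⊥, which would not determine the letter.
  · let F : Set 𝓐 := ⋃ z ∈ Z, {a | ∃ (δ : List 𝓐) (D : L.FamAt (α ++ a :: δ)),
      D.1.Nonempty ∧ z = ES.ofSet (α ++ a :: δ) D}
    have hF : F.Finite := by
      refine Z.finite_toSet.biUnion fun z _ => Set.Subsingleton.finite ?_
      rintro a ⟨δ, D, hD, rfl⟩ b ⟨δ', D', -, hDD'⟩
      refine ES.letter_eq (A := D) (B := D') ?_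
      rw [← hDD', inf_idem]
      exact ES.ofSet_ne_bot_iff.2 hD
    obtain ⟨a, ⟨e, hes, hea⟩, haF⟩ := (hinf.sdiff hF).nonempty
    refine ⟨ES.ofSet (α ++ [a]) (A.relRange [a]), ES.ofSet_relRange_le A [a],
      ES.ofSet_ne_bot_iff.2 ⟨L.r e, L.s e, hes, hea ▸ .cons e (.nil _)⟩, fun b δ D hD => ?_⟩
    by_contra hne0
    obtain rfl : b = a := ES.letter_eq hne0
    refine haF (Set.mem_biUnion hD ⟨δ, D, ES.ofSet_ne_bot_iff.1 ?_, rfl⟩)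
    intro h0
    exact hne0 (by rw [h0, bot_inf_eq])
  -- A common point with a proper extension of `α` would require an edge leaving `B`, which consists
  -- of sinks.
  · refine ⟨ES.ofSet α B, ES.ofSet_mono fun u hu => (hBs hu).1, ES.ofSet_ne_bot_iff.2 hB,
      fun a δ D _ => ?_⟩
    by_contra hne0
    obtain ⟨⟨μ, v⟩, hx⟩ := ES.ne_bot_iff.1 hne0
    rw [ES.points_inf] at hx
    obtain ⟨ε, rfl, -⟩ := ES.mem_points_ofSet.1 hx.1
    have hv := hx.2
    rw [List.append_assoc, ES.append_mem_points_ofSet] at hv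
    obtain ⟨e, he, -⟩ := exists_edge_of_mem_relRange_cons hv
    exact (hBs he).2 e rfl

end ClosedUnderRelCompl

end LabelledSpace

/-- Characterization of the tight filters in `E(S)` for a weakly left resolving labelled space
whose accommodating family is closed under relative complements. -/
theorem mainTheorem1 {V E 𝓐 : Type*} [Nonempty E] (L : LabelledSpace V E 𝓐)
    [L.WeaklyLeftResolving] [L.ClosedUnderRelCompl] (ξ : Set L.ES) :
    IsTightFilter ξ ↔
      (LabelledSpace.IsInfiniteType ξ ∧ IsOrderUltrafilter ξ) ∨
      (IsOrderFilter ξ ∧ ∃ α : List 𝓐, LabelledSpace.IsLargestWord ξ α ∧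
        IsOrderUltrafilter (LabelledSpace.levelSet ξ α) ∧
        ∀ A ∈ LabelledSpace.levelSet ξ α,
          (L.labelsFrom A.1).Infinite ∨
            ∃ B : L.FamAt α, B.1.Nonempty ∧ B.1 ⊆ A.1 ∩ L.sinks) := by

  constructor
  · intro h
    by_cases hα : ∃ α : List 𝓐, LabelledSpace.IsLargestWord ξ α
    · obtain ⟨α, hα⟩ := hα
      exact Or.inr ⟨h.1, α, hα, LabelledSpace.levelSet_isOrderUltrafilter h hα.1,
        fun A hA => LabelledSpace.infinite_labelsFrom_or_exists_sinks h hα hA⟩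
    · have hi : LabelledSpace.IsInfiniteType ξ := ⟨h.1, hα⟩
      exact Or.inl ⟨hi, hi.isOrderUltrafilter h⟩
  · rintro (⟨-, h⟩ | ⟨h, α, hα, hu, hc⟩)
    · exact h.isTightFilter
    · exact hα.isTightFilter h hu hc
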